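/- Let $A$ be a non-empty set. For $a\in A$ let $\delta_a:\mathbb{R}^A\to\mathbb{R}$, $\delta_a(\xi)=\xi(a)$, and let $FVL(A)$ be the vector sublattice of $\mathbb{R}^{\mathbb{R}^A}$ (with pointwise operations) generated by $\{\delta_a:a\in A\}$. Then $(FVL(A),a\mapsto\delta_a)$ is the free vector lattice over $A$: for every real vector lattice $E$ and every map $\phi:A\to E$ there is a unique vector lattice homomorphism $T:FVL(A)\to E$ with $T(\delta_a)=\phi(a)$ for all $a\in A$. Let $FVL(A)^\sim$ be the space of order bounded linear functionals on $FVL(A)$, with positive cone $FVL(A)^\sim_+$. The formula $$\|f\|_F=\sup\Big\{\varphi(|f|):\varphi\in FVL(A)^\sim_+,\ \sup_{a\in A}\varphi(|\delta_a|)\le 1\Big\}\qquad(f\in FVL(A))$$ defines a (finite) lattice norm on $FVL(A)$. The normed lattice $(FVL(A),\|\cdot\|_F)$ has a completion that is a Banach lattice, i.e. there are a Banach lattice $X$ and an isometric lattice homomorphism $j:FVL(A)\to X$ with dense range; and for every such completion $(X,j)$ the pair $(X,\iota)$ with $\iota(a)=j(\delta_a)$ is the free Banach lattice $FBL(A)$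 over $A$: the map $\iota:A\to X$ is bounded and, for every Banach lattice $Y$ and every bounded map $\kappa:A\to Y$, there is a unique linear lattice homomorphism $T:X\to Y$ with $T(\iota(a))=\kappa(a)$ for all $a\in A$, and it is bounded with $\|T\|=\sup\{\|\kappa(a)\|:a\in A\}$. -/

import Mathlib

universe u v w

/-- A real vector lattice (Riesz space): a partially ordered real vector space that is a lattice. -/
class IsVectorLattice (E : Type*) [AddCommGroup E] [Module ℝ E] [Lattice E] : Prop
    extends IsOrderedAddMonoid E, IsOrderedModule ℝ E

/-- A Banach lattice: a vector lattice with a complete norm that is monotone in the modulus. -/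
class IsBanachLattice (X : Type*) [NormedAddCommGroup X] [NormedSpace ℝ X] [Lattice X] : Prop
    extends IsVectorLattice X, HasSolidNorm X, CompleteSpace X

/-- A linear map is a vector lattice homomorphism if it preserves finite suprema and infima. -/
def IsLatticeHom {E F : Type*} [AddCommGroup E] [Module ℝ E] [Lattice E]
    [AddCommGroup F] [Module ℝ F] [Lattice F] (T : E →ₗ[ℝ] F) : Prop :=
  (∀ x y, T (x ⊔ y) = T x ⊔ T y) ∧ ∀ x y, T (x ⊓ y) = T x ⊓ T y

section Sublattice

variable {L : Type*} [AddCommGroup L] [Module ℝ L] [Lattice L]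

/-- A linear subspace that is closed under binary suprema and infima. -/
def IsVectorSublattice (S : Submodule ℝ L) : Prop :=
  (∀ x ∈ S, ∀ y ∈ S, x ⊔ y ∈ S) ∧ ∀ x ∈ S, ∀ y ∈ S, x ⊓ y ∈ S

/-- The vector sublattice generated by a set: the smallest vector sublattice containing it. -/
def generatedSublattice (D : Set L) : Submodule ℝ L :=
  sInf {S | IsVectorSublattice S ∧ D ⊆ S}

theorem subset_generatedSublattice (D : Set L) : D ⊆ generatedSublattice D := by
  intro x hx
  exact (Submodule.mem_sInf).2 fun S hS => hS.2 hx

theorem isVectorSublattice_generatedSublattice (D : Set L) :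
    IsVectorSublattice (generatedSublattice D) := by
  refine ⟨fun x hx y hy => (Submodule.mem_sInf).2 fun S hS => hS.1.1 x ?_ y ?_,
    fun x hx y hy => (Submodule.mem_sInf).2 fun S hS => hS.1.2 x ?_ y ?_⟩
  · exact (Submodule.mem_sInf).1 hx S hS
  · exact (Submodule.mem_sInf).1 hy S hS
  · exact (Submodule.mem_sInf).1 hx S hS
  · exact (Submodule.mem_sInf).1 hy S hS

/-- The lattice structure that the generated sublattice inherits from the ambient space. -/
instance generatedSublattice.instLattice (D : Set L) : Lattice (generatedSublattice D) :=
  Subtype.lattice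
    (fun {x y} hx hy => (isVectorSublattice_generatedSublattice D).1 x hx y hy)
    (fun {x y} hx hy => (isVectorSublattice_generatedSublattice D).2 x hx y hy)

end Sublattice

/-- The evaluation function `ξ ↦ ξ a` on `ℝ^A`. -/
def evalFun {A : Type*} (a : A) : (A → ℝ) → ℝ := fun ξ => ξ a

/-- The vector sublattice of `ℝ^(ℝ^A)` (with pointwise operations and order) that is generated by
the evaluation functions. -/
abbrev FVL (A : Type*) : Type _ :=
  generatedSublattice (Set.range (evalFun : A → (A → ℝ) → ℝ))

/-- The generators of `FVL A`. -/
def FVL.delta {A : Type*} (a : A) : FVL A :=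
  ⟨evalFun a, subset_generatedSublattice _ ⟨a, rfl⟩⟩

/-- `(F, ι)` is a free vector lattice over `A`, tested against vector lattices in the
universe `w`. -/
def IsFreeVectorLattice {A : Type u} {F : Type v} [AddCommGroup F] [Module ℝ F]
    [Lattice F] (ι : A → F) : Prop :=
  IsVectorLattice F ∧
  ∀ (E : Type w) [AddCommGroup E] [Module ℝ E] [Lattice E] [IsVectorLattice E] (φ : A → E),
    ∃! T : F →ₗ[ℝ] E, IsLatticeHom T ∧ ∀ a, T (ι a) = φ a

/-- `(X, ι)` is a free Banach lattice over `A`, tested against Banach lattices in the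
universe `w`. Uniqueness is required among all linear lattice homomorphisms that extend `κ`,
without any condition on their continuity or norm. -/
def IsFreeBanachLattice {A : Type u} {X : Type v} [NormedAddCommGroup X]
    [NormedSpace ℝ X] [Lattice X] (ι : A → X) : Prop :=
  IsBanachLattice X ∧ Bornology.IsBounded (Set.range ι) ∧
  ∀ (Y : Type w) [NormedAddCommGroup Y] [NormedSpace ℝ Y] [Lattice Y] [IsBanachLattice Y]
    (κ : A → Y), Bornology.IsBounded (Set.range κ) →
    ∃ T : X →L[ℝ] Y,
      (IsLatticeHom (T : X →ₗ[ℝ] Y) ∧ (∀ a, T (ι a) = κ a) ∧ ‖T‖ = ⨆ a, ‖κ a‖) ∧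
      ∀ S : X →ₗ[ℝ] Y, IsLatticeHom S → (∀ a, S (ι a) = κ a) → S = (T : X →ₗ[ℝ] Y)

/-- Membership in the order dual: a linear functional that is bounded on order intervals. -/
def IsOrderBounded {L : Type*} [AddCommGroup L] [Module ℝ L] [Lattice L] (φ : L →ₗ[ℝ] ℝ) : Prop :=
  ∀ x y : L, Bornology.IsBounded (φ '' Set.Icc x y)

/-- The positive functionals `φ` in the order dual of `FVL A` with `φ |δ_a| ≤ 1` for every `a`. -/
def FVL.dualUnitBallPos (A : Type*) : Set (FVL A →ₗ[ℝ] ℝ) :=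
  {φ | IsOrderBounded φ ∧ (∀ f, 0 ≤ f → 0 ≤ φ f) ∧ ∀ a : A, φ |FVL.delta a| ≤ 1}

/-- The set of values whose supremum is the free norm of `f`. -/
def FVL.normValues {A : Type*} (f : FVL A) : Set ℝ :=
  (fun φ : FVL A →ₗ[ℝ] ℝ => φ |f|) '' FVL.dualUnitBallPos A

/-- The free norm `‖f‖_F`. -/
noncomputable def FVL.freeNorm {A : Type*} (f : FVL A) : ℝ := sSup (FVL.normValues f)

/-- `N` is a lattice norm on `L`. -/
structure IsLatticeNorm {L : Type*} [AddCommGroup L] [Module ℝ L] [Lattice L] (N : L → ℝ) :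
    Prop where
  add_le : ∀ x y, N (x + y) ≤ N x + N y
  smul : ∀ (c : ℝ) (x : L), N (c • x) = |c| * N x
  eq_zero : ∀ x, N x = 0 → x = 0
  solid : ∀ x y : L, |x| ≤ |y| → N x ≤ N y

/-- `j : L → X` exhibits the Banach lattice `X` as the completion of `L` with the norm `N`:
`j` is an isometric lattice homomorphism onto a dense vector sublattice. -/
structure IsLatticeCompletion {L X : Type*} [AddCommGroup L] [Module ℝ L] [Lattice L]
    [NormedAddCommGroup X] [NormedSpace ℝ X] [Lattice X] (N : L → ℝ) (j : L →ₗ[ℝ] X) :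
    Prop where
  isBanachLattice : IsBanachLattice X
  isLatticeHom : IsLatticeHom j
  norm_eq : ∀ f, ‖j f‖ = N f
  denseRange : DenseRange j

/-! Extending `φ : A → E` to `FVL A` means showing that the sublattice of `ℝ^(ℝ^A) × E` generated by
the pairs `(δ_a, φ a)` is a graph, that is, `x.1 ≤ 0` forces `x.2 ≤ 0` on it. Its elements are
finite suprema of finite infima of linear combinations, so infima suffice. If such an infimum is
pointwise nonpositive, Gordan's alternative yields a convex combination of the coefficient vectors
that vanishes; the same combination in `E` is `0` and dominates the infimum there
(`snd_nonpos_of_mem_infClosure_span`). No Archimedean property or representation of `E` is involved.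

The free norm is definite because suitably scaled evaluations at bounded points are admissible
functionals. It is the largest lattice seminorm that is at most `1` on the generators: a positive
norming functional on the target pulls back to an admissible one (`norm_apply_le_mul_freeNorm`).
Hence homomorphisms extend boundedly to the completion, and uniqueness without a continuity
assumption follows from automatic continuity (`IsLatticeHom.exists_norm_le`). -/

/-! ### Vector lattices and generated sublattices. -/

section VectorLattice

variable {E F : Type*} [AddCommGroup E] [Module ℝ E] [Lattice E]
  [AddCommGroup F] [Module ℝ F] [Lattice F]

theorem smul_sup_of_nonneg [IsVectorLattice E] {c : ℝ} (hc : 0 ≤ c) (x y : E) :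
    c • (x ⊔ y) = c • x ⊔ c • y := by
  rcases hc.eq_or_lt with rfl | hc
  · simp
  · exact (OrderIso.smulRight (β := E) hc).map_sup x y

theorem smul_inf_of_nonneg [IsVectorLattice E] {c : ℝ} (hc : 0 ≤ c) (x y : E) :
    c • (x ⊓ y) = c • x ⊓ c • y := by
  rcases hc.eq_or_lt with rfl | hc
  · simp
  · exact (OrderIso.smulRight (β := E) hc).map_inf x y

theorem smul_sup_of_nonpos [IsVectorLattice E] {c : ℝ} (hc : c ≤ 0) (x y : E) :
    c • (x ⊔ y) = c • x ⊓ c • y := by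
  have h := congrArg Neg.neg (smul_sup_of_nonneg (neg_nonneg.2 hc) x y)
  rwa [neg_sup, neg_smul, neg_smul, neg_smul, neg_neg, neg_neg, neg_neg] at h

theorem smul_inf_of_nonpos [IsVectorLattice E] {c : ℝ} (hc : c ≤ 0) (x y : E) :
    c • (x ⊓ y) = c • x ⊔ c • y := by
  have h := congrArg Neg.neg (smul_inf_of_nonneg (neg_nonneg.2 hc) x y)
  rwa [neg_inf, neg_smul, neg_smul, neg_smul, neg_neg, neg_neg, neg_neg] at h

theorem IsVectorLattice.abs_smul [IsVectorLattice E] (c : ℝ) (x : E) : |c • x| = |c| • |x| := by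
  rcases le_total 0 c with hc | hc
  · rw [abs_of_nonneg hc, abs, abs, smul_sup_of_nonneg hc, smul_neg]
  · rw [abs_of_nonpos hc, abs, abs, smul_sup_of_nonneg (neg_nonneg.2 hc), neg_smul, smul_neg,
      neg_smul, neg_neg, sup_comm]

theorem IsLatticeHom.map_abs {T : E →ₗ[ℝ] F} (hT : IsLatticeHom T) (x : E) : T |x| = |T x| := by
  rw [abs, abs, hT.1, map_neg]

theorem IsLatticeHom.monotone {T : E →ₗ[ℝ] F} (hT : IsLatticeHom T) : Monotone T := by
  intro x y h
  rw [← sup_eq_right.2 h, hT.1]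
  exact le_sup_left

theorem abs_sup_le_add_abs [IsVectorLattice E] (x y : E) : |x ⊔ y| ≤ |x| + |y| := by
  refine abs_le'.2 ⟨sup_le ?_ ?_, ?_⟩
  · exact (le_abs_self x).trans (le_add_of_nonneg_right (abs_nonneg y))
  · exact (le_abs_self y).trans (le_add_of_nonneg_left (abs_nonneg x))
  · rw [neg_sup]
    exact inf_le_left.trans ((neg_le_abs x).trans (le_add_of_nonneg_right (abs_nonneg y)))

theorem abs_inf_le_add_abs [IsVectorLattice E] (x y : E) : |x ⊓ y| ≤ |x| + |y| := by
  rw [← abs_neg, neg_inf, ← abs_neg x, ← abs_neg y]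
  exact abs_sup_le_add_abs _ _

instance Prod.instIsVectorLattice [IsVectorLattice E] [IsVectorLattice F] :
    IsVectorLattice (E × F) where
  add_le_add_left _ _ h _ := add_le_add_left h _
  smul_le_smul_of_nonneg_left _ hc _ _ h :=
    ⟨smul_le_smul_of_nonneg_left h.1 hc, smul_le_smul_of_nonneg_left h.2 hc⟩
  smul_le_smul_of_nonneg_right _ hx _ _ h :=
    ⟨smul_le_smul_of_nonneg_right h hx.1, smul_le_smul_of_nonneg_right h hx.2⟩

instance Pi.instIsVectorLattice {ι : Type*} : IsVectorLattice (ι → ℝ) where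
  add_le_add_left _ _ h _ := add_le_add_left h _
  smul_le_smul_of_nonneg_left _ hc _ _ h := fun i => mul_le_mul_of_nonneg_left (h i) hc
  smul_le_smul_of_nonneg_right _ hx _ _ h := fun i => mul_le_mul_of_nonneg_right h (hx i)

instance generatedSublattice.instIsVectorLattice [IsVectorLattice E] (D : Set E) :
    IsVectorLattice (generatedSublattice D) where
  add_le_add_left _ _ h _ := add_le_add_left (α := E) h _
  smul_le_smul_of_nonneg_left _ hc _ _ h := smul_le_smul_of_nonneg_left (β := E) h hc
  smul_le_smul_of_nonneg_right _ hx _ _ h := smul_le_smul_of_nonneg_right (β := E) h hx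

theorem generatedSublattice_induction {D : Set E} {p : generatedSublattice D → Prop}
    (mem : ∀ x (hx : x ∈ D), p ⟨x, subset_generatedSublattice D hx⟩) (zero : p 0)
    (add : ∀ x y, p x → p y → p (x + y)) (smul : ∀ (c : ℝ) x, p x → p (c • x))
    (sup : ∀ x y, p x → p y → p (x ⊔ y)) (inf : ∀ x y, p x → p y → p (x ⊓ y))
    (x : generatedSublattice D) : p x := by
  let S : Submodule ℝ E :=
    { carrier := {x | ∃ h, p ⟨x, h⟩}
      zero_mem' := ⟨zero_mem _, zero⟩
      add_mem' := fun ⟨_, ha⟩ ⟨_, hb⟩ => ⟨_, add _ _ ha hb⟩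
      smul_mem' := fun c _ ⟨_, ha⟩ => ⟨_, smul c _ ha⟩ }
  have hS : IsVectorSublattice S :=
    ⟨fun _ ⟨_, ha⟩ _ ⟨_, hb⟩ => ⟨_, sup _ _ ha hb⟩, fun _ ⟨_, ha⟩ _ ⟨_, hb⟩ => ⟨_, inf _ _ ha hb⟩⟩
  obtain ⟨_, hx⟩ := (Submodule.mem_sInf).1 x.2 S ⟨hS, fun y hy => ⟨_, mem y hy⟩⟩
  exact hx

/-- In a vector lattice, the lattice closure of the span of `D` is already a vector sublattice,
so it contains the vector sublattice generated by `D`. -/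
theorem generatedSublattice_subset_latticeClosure [IsVectorLattice E] (D : Set E) :
    (generatedSublattice D : Set E) ⊆ latticeClosure (Submodule.span ℝ D : Set E) := by
  set V : Set E := (Submodule.span ℝ D : Set E) with hV
  have hsub : V ⊆ latticeClosure V := subset_latticeClosure
  have hlat : IsSublattice (latticeClosure V) := isSublattice_latticeClosure
  -- Closure under addition is proved one summand at a time, because minimality of the lattice
  -- closure handles a single variable.
  have add_right : ∀ y ∈ V, ∀ x ∈ latticeClosure V, x + y ∈ latticeClosure V := by
    intro y hy x hx
    refine latticeClosure_min (t := {x | x + y ∈ latticeClosure V})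
      (fun z hz => hsub (add_mem (S := Submodule ℝ E) hz hy)) ⟨?_, ?_⟩ hx
    · intro a ha b hb
      change a ⊔ b + y ∈ latticeClosure V
      rw [sup_add]
      exact hlat.supClosed ha hb
    · intro a ha b hb
      change a ⊓ b + y ∈ latticeClosure V
      rw [inf_add]
      exact hlat.infClosed ha hb
  let S : Submodule ℝ E :=
    { carrier := latticeClosure V
      zero_mem' := hsub (zero_mem (Submodule.span ℝ D))
      add_mem' := by
        intro x y hx hy
        refine latticeClosure_min (t := {y | x + y ∈ latticeClosure V})
          (fun z hz => add_right z hz x hx) ⟨?_, ?_⟩ hy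
        · intro a ha b hb
          change x + a ⊔ b ∈ latticeClosure V
          rw [add_sup]
          exact hlat.supClosed ha hb
        · intro a ha b hb
          change x + a ⊓ b ∈ latticeClosure V
          rw [add_inf]
          exact hlat.infClosed ha hb
      smul_mem' := by
        intro c x hx
        refine latticeClosure_min (t := {x | c • x ∈ latticeClosure V})
          (fun z hz => hsub (Submodule.smul_mem (Submodule.span ℝ D) c hz)) ⟨?_, ?_⟩ hx
        · intro a ha b hb
          change c • (a ⊔ b) ∈ latticeClosure V
          rcases le_total 0 c with hc | hc
          · rw [smul_sup_of_nonneg hc]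
            exact hlat.supClosed ha hb
          · rw [smul_sup_of_nonpos hc]
            exact hlat.infClosed ha hb
        · intro a ha b hb
          change c • (a ⊓ b) ∈ latticeClosure V
          rcases le_total 0 c with hc | hc
          · rw [smul_inf_of_nonneg hc]
            exact hlat.infClosed ha hb
          · rw [smul_inf_of_nonpos hc]
            exact hlat.supClosed ha hb }
  exact fun x hx => (Submodule.mem_sInf).1 hx S
    ⟨⟨fun _ ha _ hb => hlat.supClosed ha hb, fun _ ha _ hb => hlat.infClosed ha hb⟩,
      fun y hy => hsub (Submodule.subset_span hy)⟩

theorem mem_supClosure_infClosure_of_mem_generatedSublattice [IsVectorLattice E] {D : Set E}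
    {x : E} (hx : x ∈ generatedSublattice D) :
    x ∈ supClosure (infClosure (Submodule.span ℝ D : Set E)) := by
  -- Lattice-ordered abelian groups are distributive, so the lattice closure consists of finite
  -- suprema of finite infima.
  let _ : DistribLattice E := AddCommGroup.toDistribLattice E
  have h := generatedSublattice_subset_latticeClosure D hx
  rw [← supClosure_infClosure] at h
  exact h

end VectorLattice

/-! ### Gordan's alternative. -/

/-- **Gordan's alternative**: if no functional is strictly positive on a finite set of vectors,
then some convex combination of them vanishes. -/
theorem zero_mem_convexHull_of_forall_exists_nonpos {V : Type*} [AddCommGroup V] [Module ℝ V]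
    [TopologicalSpace V] [IsTopologicalAddGroup V] [ContinuousSMul ℝ V] [LocallyConvexSpace ℝ V]
    [T2Space V] {s : Set V} (hs : s.Finite) (h : ∀ f : V →L[ℝ] ℝ, ∃ x ∈ s, f x ≤ 0) :
    (0 : V) ∈ convexHull ℝ s := by
  by_contra h0
  obtain ⟨f, r, hf0, hf⟩ := geometric_hahn_banach_point_closed (convex_convexHull ℝ s)
    (hs.isClosed_convexHull ℝ) h0
  obtain ⟨x, hx, hfx⟩ := h f
  have := hf x (subset_convexHull ℝ s hx)
  rw [map_zero] at hf0
  linarith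

/-- Finitely supported vectors embed in `ℝ^A` with the product topology, where separation applies.
On them a continuous functional `f` is the pairing with `ξ a = f (Pi.single a 1)`, so the hypothesis
on all `ξ` covers every `f`; injectivity brings the conclusion back. -/
theorem Finsupp.zero_mem_convexHull_of_forall_exists_nonpos {A : Type*} {s : Set (A →₀ ℝ)}
    (hs : s.Finite) (h : ∀ ξ : A → ℝ, ∃ c ∈ s, Finsupp.linearCombination ℝ ξ c ≤ 0) :
    (0 : A →₀ ℝ) ∈ convexHull ℝ s := by
  classical
  have key : (0 : A → ℝ) ∈ convexHull ℝ ((Finsupp.lcoeFun : (A →₀ ℝ) →ₗ[ℝ] (A → ℝ)) '' s) := by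
    refine _root_.zero_mem_convexHull_of_forall_exists_nonpos (hs.image _) fun f => ?_
    obtain ⟨c, hc, hle⟩ := h fun a => f (Pi.single a 1)
    refine ⟨_, ⟨c, hc, rfl⟩, ?_⟩
    have : (f : (A → ℝ) →ₗ[ℝ] ℝ) ∘ₗ Finsupp.lcoeFun =
        Finsupp.linearCombination ℝ fun a => f (Pi.single a 1) := by
      ext a
      simp [Finsupp.single_eq_pi_single]
    rw [← this] at hle
    exact hle
  rw [← LinearMap.image_convexHull] at key
  obtain ⟨c, hc, h0⟩ := key
  have : c = 0 := DFunLike.coe_injective h0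
  rwa [this] at hc

/-! ### The free vector lattice. -/

section Free

variable {A : Type*} {E : Type*} [AddCommGroup E] [Module ℝ E] [Lattice E]

/-- The pairs `(δ_a, φ a)`. They generate the graph of the homomorphism that extends `φ`. -/
def graphGenerators (φ : A → E) : Set (((A → ℝ) → ℝ) × E) := Set.range fun a => (evalFun a, φ a)

theorem snd_nonpos_of_mem_infClosure_span [IsVectorLattice E] (φ : A → E)
    {x : ((A → ℝ) → ℝ) × E}
    (hx : x ∈ infClosure (Submodule.span ℝ (graphGenerators φ) : Set (((A → ℝ) → ℝ) × E)))
    (h : x.1 ≤ 0) : x.2 ≤ 0 := by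
  obtain ⟨t, ht, hts, rfl⟩ := hx
  rw [graphGenerators, ← Finsupp.range_linearCombination] at hts
  -- `g y` is a coefficient vector of `y`; both coordinates of `y` are read off from it.
  choose! g hg using fun y (hy : y ∈ t) => hts hy
  have fst_eq : ∀ c ξ, (Finsupp.linearCombination ℝ (fun a => (evalFun a, φ a)) c).1 ξ =
      Finsupp.linearCombination ℝ ξ c := by
    intro c ξ
    induction c using Finsupp.induction_linear with
    | zero => simp
    | add c d hc hd => simp [hc, hd]
    | single a r => simp [evalFun]
  have snd_eq : ∀ c, (Finsupp.linearCombination ℝ (fun a => (evalFun a, φ a)) c).2 =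
      Finsupp.linearCombination ℝ φ c := by
    intro c
    induction c using Finsupp.induction_linear with
    | zero => simp
    | add c d hc hd => simp [hc, hd]
    | single a r => simp
  have h0 : (0 : A →₀ ℝ) ∈ convexHull ℝ (g '' t) := by
    refine Finsupp.zero_mem_convexHull_of_forall_exists_nonpos (t.finite_toSet.image g) fun ξ => ?_
    have h1 : t.inf' ht (fun y => y.1 ξ) ≤ 0 := by
      have := Finset.apply_inf'_eq_inf'_comp ht (f := id)
        (fun y : ((A → ℝ) → ℝ) × E => y.1 ξ) (fun _ _ => rfl)
      exact this.symm.le.trans (h ξ)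
    obtain ⟨y, hy, hle⟩ := (Finset.inf'_le_iff ht).1 h1
    refine ⟨g y, ⟨y, hy, rfl⟩, ?_⟩
    rw [← fst_eq, hg y hy]
    exact hle
  -- The coefficient vectors whose combination in `E` dominates the infimum form a convex set. It
  -- contains every `g y`, hence also `0`.
  have hconv : Convex ℝ ((Finsupp.linearCombination ℝ φ) ⁻¹' Set.Ici (t.inf' ht id).2) :=
    (convex_Ici _).linear_preimage _
  have hsub : g '' t ⊆ (Finsupp.linearCombination ℝ φ) ⁻¹' Set.Ici (t.inf' ht id).2 := by
    rintro _ ⟨y, hy, rfl⟩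
    change (t.inf' ht id).2 ≤ Finsupp.linearCombination ℝ φ (g y)
    rw [← snd_eq, hg y hy]
    exact (Finset.inf'_le id hy).2
  have := convexHull_min hsub hconv h0
  rwa [Set.mem_preimage, map_zero] at this

theorem snd_nonpos_of_mem_generatedSublattice [IsVectorLattice E] (φ : A → E)
    {x : ((A → ℝ) → ℝ) × E} (hx : x ∈ generatedSublattice (graphGenerators φ))
    (h : x.1 ≤ 0) : x.2 ≤ 0 := by
  obtain ⟨t, ht, hts, rfl⟩ := mem_supClosure_infClosure_of_mem_generatedSublattice hx
  have h2 := Finset.apply_sup'_eq_sup'_comp ht (f := id)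
    (Prod.snd : ((A → ℝ) → ℝ) × E → E) (fun _ _ => rfl)
  rw [h2]
  exact Finset.sup'_le _ _ fun y hy => snd_nonpos_of_mem_infClosure_span φ (hts hy)
    (le_trans (Finset.le_sup' id hy).1 h)

theorem snd_eq_of_mem_generatedSublattice [IsVectorLattice E] (φ : A → E)
    {f : (A → ℝ) → ℝ} {e e' : E} (h : (f, e) ∈ generatedSublattice (graphGenerators φ))
    (h' : (f, e') ∈ generatedSublattice (graphGenerators φ)) : e = e' := by
  refine le_antisymm ?_ ?_
  · have := snd_nonpos_of_mem_generatedSublattice φ (sub_mem h h') (by simp)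
    exact sub_nonpos.1 this
  · have := snd_nonpos_of_mem_generatedSublattice φ (sub_mem h' h) (by simp)
    exact sub_nonpos.1 this

theorem FVL.induction {p : FVL A → Prop} (delta : ∀ a, p (FVL.delta a)) (zero : p 0)
    (add : ∀ x y, p x → p y → p (x + y)) (smul : ∀ (c : ℝ) x, p x → p (c • x))
    (sup : ∀ x y, p x → p y → p (x ⊔ y)) (inf : ∀ x y, p x → p y → p (x ⊓ y))
    (f : FVL A) : p f :=
  generatedSublattice_induction (by rintro _ ⟨a, rfl⟩; exact delta a) zero add smul sup inf f

/-- The generated sublattice of pairs is the graph of `T`. Each identity for `T` compares two points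
of the graph over the same `f`. -/
theorem FVL.exists_latticeHom [IsVectorLattice E] (φ : A → E) :
    ∃ T : FVL A →ₗ[ℝ] E, IsLatticeHom T ∧ ∀ a, T (FVL.delta a) = φ a := by
  have hG := isVectorSublattice_generatedSublattice (graphGenerators φ)
  have hex : ∀ f : FVL A, ∃ e, ((f : (A → ℝ) → ℝ), e) ∈
      generatedSublattice (graphGenerators φ) := by
    refine FVL.induction ?_ ?_ ?_ ?_ ?_ ?_
    · exact fun a => ⟨φ a, subset_generatedSublattice _ ⟨a, rfl⟩⟩
    · exact ⟨0, zero_mem _⟩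
    · exact fun x y ⟨d, hd⟩ ⟨e, he⟩ => ⟨d + e, add_mem hd he⟩
    · exact fun c x ⟨d, hd⟩ => ⟨c • d, Submodule.smul_mem _ c hd⟩
    · exact fun x y ⟨d, hd⟩ ⟨e, he⟩ => ⟨d ⊔ e, hG.1 _ hd _ he⟩
    · exact fun x y ⟨d, hd⟩ ⟨e, he⟩ => ⟨d ⊓ e, hG.2 _ hd _ he⟩
  choose T hT using hex
  exact
    ⟨{ toFun := T
       map_add' := fun x y =>
         snd_eq_of_mem_generatedSublattice φ (hT (x + y)) (add_mem (hT x) (hT y))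
       map_smul' := fun c x =>
         snd_eq_of_mem_generatedSublattice φ (hT (c • x)) (Submodule.smul_mem _ c (hT x)) },
      ⟨fun x y => snd_eq_of_mem_generatedSublattice φ (hT (x ⊔ y)) (hG.1 _ (hT x) _ (hT y)),
       fun x y => snd_eq_of_mem_generatedSublattice φ (hT (x ⊓ y)) (hG.2 _ (hT x) _ (hT y))⟩,
      fun a => snd_eq_of_mem_generatedSublattice φ (hT (FVL.delta a))
        (subset_generatedSublattice _ ⟨a, rfl⟩)⟩

theorem FVL.latticeHom_ext {S T : FVL A →ₗ[ℝ] E} (hS : IsLatticeHom S) (hT : IsLatticeHom T)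
    (h : ∀ a, S (FVL.delta a) = T (FVL.delta a)) : S = T := by
  refine LinearMap.ext (FVL.induction h (by simp) ?_ ?_ ?_ ?_)
  · intro x y hx hy
    rw [map_add, map_add, hx, hy]
  · intro c x hx
    rw [map_smul, map_smul, hx]
  · intro x y hx hy
    rw [hS.1, hT.1, hx, hy]
  · intro x y hx hy
    rw [hS.2, hT.2, hx, hy]

theorem FVL.isFreeVectorLattice (A : Type u) :
    IsFreeVectorLattice.{u, u, w} (FVL.delta : A → FVL A) := by
  refine ⟨inferInstance, fun E _ _ _ _ φ => ?_⟩
  obtain ⟨T, hT, h⟩ := FVL.exists_latticeHom φ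
  exact ⟨T, ⟨hT, h⟩, fun S hS => FVL.latticeHom_ext hS.1 hT fun a => (hS.2 a).trans (h a).symm⟩

end Free

/-! ### Positive functionals. -/

section PositiveFunctionals

variable {L : Type*} [AddCommGroup L] [Module ℝ L] [Lattice L]

theorem monotone_of_nonneg [IsVectorLattice L] {φ : L →ₗ[ℝ] ℝ} (h : ∀ f, 0 ≤ f → 0 ≤ φ f) :
    Monotone φ := fun x y hxy => by
  simpa using h (y - x) (sub_nonneg.2 hxy)

theorem isOrderBounded_of_monotone {φ : L →ₗ[ℝ] ℝ} (h : Monotone φ) : IsOrderBounded φ := by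
  intro x y
  refine (Metric.isBounded_Icc (φ x) (φ y)).subset ?_
  rintro _ ⟨z, hz, rfl⟩
  exact ⟨h hz.1, h hz.2⟩

/-- In a normed lattice, the norm of a positive element is attained by a positive contractive
functional. -/
theorem exists_nonneg_functional_norming {Y : Type*} [NormedAddCommGroup Y] [NormedSpace ℝ Y]
    [Lattice Y] [IsVectorLattice Y] [HasSolidNorm Y] {x : Y} (hx : 0 ≤ x) :
    ∃ g : Y →ₗ[ℝ] ℝ, (∀ y, 0 ≤ y → 0 ≤ g y) ∧ (∀ y, g y ≤ ‖y‖) ∧ g x = ‖x‖ := by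
  rcases eq_or_ne x 0 with rfl | hx0
  · exact ⟨0, by simp, by simp, by simp⟩
  have norm_mono : ∀ y z : Y, 0 ≤ y → y ≤ z → ‖y‖ ≤ ‖z‖ := fun y z hy hyz =>
    norm_le_norm_of_abs_le_abs (by rwa [abs_of_nonneg hy, abs_of_nonneg (hy.trans hyz)])
  let f : Y →ₗ.[ℝ] ℝ := LinearPMap.mkSpanSingleton x ‖x‖ hx0
  have f_apply : ∀ (c : ℝ) (h : c • x ∈ f.domain), f ⟨c • x, h⟩ = c * ‖x‖ :=
    LinearPMap.mkSpanSingleton'_apply (σ := RingHom.id ℝ) x ‖x‖ _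
  have hf : ∀ y : f.domain, f y ≤ ‖(y : Y) ⊔ 0‖ := by
    rintro ⟨y, hy⟩
    obtain ⟨c, rfl⟩ := Submodule.mem_span_singleton.1 hy
    rw [f_apply]
    rcases le_total 0 c with hc | hc
    · rw [sup_eq_left.2 (smul_nonneg hc hx), norm_smul, Real.norm_of_nonneg hc]
    · exact (mul_nonpos_of_nonpos_of_nonneg hc (norm_nonneg x)).trans (norm_nonneg _)
  -- Dominating by `‖y ⊔ 0‖` instead of `‖y‖` makes the extension positive: for `y ≥ 0` it gives `g
  -- (-y) ≤ 0`.
  obtain ⟨g, hg, hle⟩ := exists_extension_of_le_sublinear f (fun y => ‖y ⊔ 0‖)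
    (fun c hc y => by
      have : c • y ⊔ 0 = c • (y ⊔ 0) := by rw [smul_sup_of_nonneg hc.le, smul_zero]
      rw [this, norm_smul, Real.norm_of_nonneg hc.le])
    (fun y z => (norm_mono _ _ le_sup_right (sup_le (add_le_add le_sup_left le_sup_left)
      (add_nonneg le_sup_right le_sup_right))).trans (norm_add_le _ _)) hf
  refine ⟨g, fun y hy => ?_, fun y => (hle y).trans ?_, ?_⟩
  · have := hle (-y)
    rw [sup_eq_right.2 (neg_nonpos.2 hy), norm_zero, map_neg] at this
    linarith
  · refine norm_le_norm_of_abs_le_abs ?_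
    rw [abs_of_nonneg le_sup_right]
    exact sup_le (le_abs_self y) (abs_nonneg y)
  · exact (hg ⟨x, Submodule.mem_span_singleton_self x⟩).trans
      (LinearPMap.mkSpanSingleton_apply ℝ ℝ hx0 ‖x‖)

end PositiveFunctionals

/-! ### The free norm. -/

namespace FVL

variable {A : Type*}

theorem abs_smul (c : ℝ) (f : FVL A) : |c • f| = |c| • |f| :=
  IsVectorLattice.abs_smul c f

theorem mem_dualUnitBallPos {φ : FVL A →ₗ[ℝ] ℝ} (h0 : ∀ f, 0 ≤ f → 0 ≤ φ f)
    (h1 : ∀ a : A, φ |delta a| ≤ 1) : φ ∈ dualUnitBallPos A :=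
  ⟨isOrderBounded_of_monotone (monotone_of_nonneg h0), h0, h1⟩

theorem monotone_of_mem_dualUnitBallPos {φ : FVL A →ₗ[ℝ] ℝ} (h : φ ∈ dualUnitBallPos A) :
    Monotone φ :=
  monotone_of_nonneg h.2.1

theorem normValues_nonempty (f : FVL A) : (normValues f).Nonempty :=
  ⟨_, 0, mem_dualUnitBallPos (by simp) (by simp), rfl⟩

theorem bddAbove_normValues (f : FVL A) : BddAbove (normValues f) := by
  suffices h : ∃ M, ∀ φ ∈ dualUnitBallPos A, φ |f| ≤ M by
    obtain ⟨M, hM⟩ := h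
    refine ⟨M, ?_⟩
    rintro _ ⟨φ, hφ, rfl⟩
    exact hM φ hφ
  have of_le : ∀ x y z : FVL A, |z| ≤ |x| + |y| →
      (∃ M, ∀ φ ∈ dualUnitBallPos A, φ |x| ≤ M) → (∃ M, ∀ φ ∈ dualUnitBallPos A, φ |y| ≤ M) →
      ∃ M, ∀ φ ∈ dualUnitBallPos A, φ |z| ≤ M := by
    rintro x y z hz ⟨M, hM⟩ ⟨M', hM'⟩
    refine ⟨M + M', fun φ hφ => (monotone_of_mem_dualUnitBallPos hφ hz).trans ?_⟩
    rw [map_add]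
    exact add_le_add (hM φ hφ) (hM' φ hφ)
  induction f using FVL.induction with
  | delta a => exact ⟨1, fun φ hφ => hφ.2.2 a⟩
  | zero => exact ⟨0, fun φ _ => by simp⟩
  | add x y hx hy => exact of_le x y _ (abs_add_le x y) hx hy
  | smul c x hx =>
    obtain ⟨M, hM⟩ := hx
    refine ⟨|c| * M, fun φ hφ => ?_⟩
    rw [FVL.abs_smul, map_smul, smul_eq_mul]
    exact mul_le_mul_of_nonneg_left (hM φ hφ) (abs_nonneg c)
  | sup x y hx hy => exact of_le x y _ (abs_sup_le_add_abs x y) hx hy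
  | inf x y hx hy => exact of_le x y _ (abs_inf_le_add_abs x y) hx hy

theorem isLUB_freeNorm (f : FVL A) : IsLUB (normValues f) (freeNorm f) :=
  isLUB_csSup (normValues_nonempty f) (bddAbove_normValues f)

theorem apply_abs_le_freeNorm {φ : FVL A →ₗ[ℝ] ℝ} (hφ : φ ∈ dualUnitBallPos A) (f : FVL A) :
    φ |f| ≤ freeNorm f :=
  (isLUB_freeNorm f).1 ⟨φ, hφ, rfl⟩

theorem freeNorm_le {f : FVL A} {M : ℝ} (h : ∀ φ ∈ dualUnitBallPos A, φ |f| ≤ M) :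
    freeNorm f ≤ M := by
  refine (isLUB_freeNorm f).2 ?_
  rintro _ ⟨φ, hφ, rfl⟩
  exact h φ hφ

theorem freeNorm_delta_le_one (a : A) : freeNorm (delta a) ≤ 1 :=
  freeNorm_le fun _ hφ => hφ.2.2 a

/-- An element of the free vector lattice depends on finitely many coordinates only. -/
theorem exists_finset_apply_eq (f : FVL A) :
    ∃ s : Finset A, ∀ ξ η : A → ℝ, (∀ a ∈ s, ξ a = η a) → f.1 ξ = f.1 η := by
  classical
  have of_two : ∀ (op : ℝ → ℝ → ℝ) (x y z : FVL A), (∀ ξ, z.1 ξ = op (x.1 ξ) (y.1 ξ)) →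
      (∃ s : Finset A, ∀ ξ η : A → ℝ, (∀ a ∈ s, ξ a = η a) → x.1 ξ = x.1 η) →
      (∃ s : Finset A, ∀ ξ η : A → ℝ, (∀ a ∈ s, ξ a = η a) → y.1 ξ = y.1 η) →
      ∃ s : Finset A, ∀ ξ η : A → ℝ, (∀ a ∈ s, ξ a = η a) → z.1 ξ = z.1 η := by
    rintro op x y z hz ⟨s, hs⟩ ⟨t, ht⟩
    refine ⟨s ∪ t, fun ξ η h => ?_⟩
    rw [hz, hz, hs ξ η fun a ha => h a (Finset.mem_union_left t ha),
      ht ξ η fun a ha => h a (Finset.mem_union_right s ha)]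
  induction f using FVL.induction with
  | delta a => exact ⟨{a}, fun ξ η h => h a (Finset.mem_singleton_self a)⟩
  | zero => exact ⟨∅, fun _ _ _ => rfl⟩
  | add x y hx hy => exact of_two (· + ·) x y _ (fun _ => rfl) hx hy
  | smul c x hx => exact of_two (fun r _ => c * r) x x _ (fun _ => rfl) hx hx
  | sup x y hx hy => exact of_two (· ⊔ ·) x y _ (fun _ => rfl) hx hy
  | inf x y hx hy => exact of_two (· ⊓ ·) x y _ (fun _ => rfl) hx hy

theorem eq_zero_of_freeNorm_eq_zero {f : FVL A} (hf : freeNorm f = 0) : f = 0 := by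
  classical
  refine Subtype.ext (funext fun ξ => ?_)
  obtain ⟨s, hs⟩ := exists_finset_apply_eq f
  -- Evaluation at an unbounded `ξ` has no admissible positive multiple. Truncating to `s` leaves
  -- the value of `f` unchanged and makes the point bounded.
  set η : A → ℝ := fun a => if a ∈ s then ξ a else 0 with hη
  rw [hs ξ η fun a ha => by simp [hη, ha]]
  -- The summand `1` keeps `M` positive even if `ξ` vanishes on `s`.
  set M : ℝ := 1 + ∑ a ∈ s, |ξ a| with hM
  have hM0 : 0 < M := by
    have := Finset.sum_nonneg fun a (_ : a ∈ s) => abs_nonneg (ξ a)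
    linarith
  have hηM : ∀ a, |η a| ≤ M := fun a => by
    by_cases ha : a ∈ s
    · have := Finset.single_le_sum (fun a (_ : a ∈ s) => abs_nonneg (ξ a)) ha
      simp only [hη, ha, if_true]
      linarith
    · simp only [hη, ha, if_false, abs_zero]
      exact hM0.le
  let φ : FVL A →ₗ[ℝ] ℝ := M⁻¹ • (LinearMap.proj η ∘ₗ Submodule.subtype _)
  have hφ : φ ∈ dualUnitBallPos A := by
    refine mem_dualUnitBallPos (fun g hg => mul_nonneg (inv_nonneg.2 hM0.le) (hg η)) fun a => ?_
    change M⁻¹ * |η a| ≤ 1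
    rw [inv_mul_le_one₀ hM0]
    exact hηM a
  have h : M⁻¹ * |f.1 η| ≤ 0 := hf ▸ apply_abs_le_freeNorm hφ f
  have : |f.1 η| ≤ 0 := nonpos_of_mul_nonpos_right h (inv_pos.2 hM0)
  exact abs_nonpos_iff.1 this

theorem isLatticeNorm_freeNorm : IsLatticeNorm (freeNorm : FVL A → ℝ) := by
  have smul_le : ∀ (c : ℝ) (f : FVL A), freeNorm (c • f) ≤ |c| * freeNorm f := fun c f =>
    freeNorm_le fun φ hφ => by
      rw [FVL.abs_smul, map_smul, smul_eq_mul]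
      exact mul_le_mul_of_nonneg_left (apply_abs_le_freeNorm hφ f) (abs_nonneg c)
  refine ⟨fun x y => freeNorm_le fun φ hφ => ?_, fun c x => le_antisymm (smul_le c x) ?_,
    fun x => eq_zero_of_freeNorm_eq_zero, fun x y h => freeNorm_le fun φ hφ =>
      (monotone_of_mem_dualUnitBallPos hφ h).trans (apply_abs_le_freeNorm hφ y)⟩
  · refine (monotone_of_mem_dualUnitBallPos hφ (abs_add_le x y)).trans ?_
    rw [map_add]
    exact add_le_add (apply_abs_le_freeNorm hφ x) (apply_abs_le_freeNorm hφ y)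
  · rcases eq_or_ne c 0 with rfl | hc
    · rw [abs_zero, zero_mul]
      -- The zero functional is admissible, which makes the norm nonnegative.
      have h : (0 : FVL A →ₗ[ℝ] ℝ) ∈ dualUnitBallPos A :=
        mem_dualUnitBallPos (by simp) (by simp)
      exact apply_abs_le_freeNorm h _
    · have h := smul_le c⁻¹ (c • x)
      rw [inv_smul_smul₀ hc, abs_inv] at h
      rwa [← le_inv_mul_iff₀ (abs_pos.2 hc)]

variable {Y : Type*} [NormedAddCommGroup Y] [NormedSpace ℝ Y] [Lattice Y]

/-- The free norm dominates every lattice seminorm that is bounded on the generators. -/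
theorem norm_apply_le_mul_freeNorm [IsVectorLattice Y] [HasSolidNorm Y] {T : FVL A →ₗ[ℝ] Y}
    (hT : IsLatticeHom T) {C : ℝ} (hC0 : 0 ≤ C) (hC : ∀ a, ‖T (delta a)‖ ≤ C) (f : FVL A) :
    ‖T f‖ ≤ C * freeNorm f := by
  rcases hC0.eq_or_lt with rfl | hC0
  · have : T = 0 := latticeHom_ext hT ⟨by simp, by simp⟩ fun a =>
      norm_le_zero_iff.1 (hC a)
    simp [this]
  obtain ⟨g, hg0, hg1, hg⟩ := exists_nonneg_functional_norming (abs_nonneg (T f))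
  -- The functional norming `|T f|`, pulled back along `T` and rescaled, is admissible.
  have hφ : C⁻¹ • (g ∘ₗ T) ∈ dualUnitBallPos A := by
    refine mem_dualUnitBallPos (fun x hx => mul_nonneg (inv_nonneg.2 hC0.le) (hg0 _ ?_)) fun a => ?_
    · simpa using hT.monotone hx
    · change C⁻¹ * g (T |delta a|) ≤ 1
      rw [inv_mul_le_one₀ hC0, hT.map_abs]
      exact (hg1 _).trans ((norm_abs_eq_norm _).le.trans (hC a))
  have h : C⁻¹ * g (T |f|) ≤ freeNorm f := apply_abs_le_freeNorm hφ f
  rwa [hT.map_abs, hg, norm_abs_eq_norm, inv_mul_le_iff₀ hC0] at h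

end FVL

/-! ### The completion of a normed lattice. -/

section Completion

open UniformSpace

variable {L : Type*} [NormedAddCommGroup L] [Lattice L] [HasSolidNorm L] [IsOrderedAddMonoid L]

theorem uniformContinuous₂_sup : UniformContinuous₂ fun x y : L => x ⊔ y := by
  have : LipschitzWith 2 fun p : L × L => p.1 ⊔ p.2 := by
    refine LipschitzWith.of_dist_le_mul fun p q => ?_
    rw [dist_eq_norm]
    refine (norm_sup_sub_sup_le_add_norm _ _ _ _).trans ?_
    rw [← dist_eq_norm, ← dist_eq_norm, NNReal.coe_ofNat, two_mul]
    exact add_le_add (le_max_left _ _) (le_max_right _ _)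
  exact this.uniformContinuous

theorem uniformContinuous₂_inf : UniformContinuous₂ fun x y : L => x ⊓ y := by
  have : LipschitzWith 2 fun p : L × L => p.1 ⊓ p.2 := by
    refine LipschitzWith.of_dist_le_mul fun p q => ?_
    rw [dist_eq_norm]
    refine (norm_inf_sub_inf_le_add_norm _ _ _ _).trans ?_
    rw [← dist_eq_norm, ← dist_eq_norm, NNReal.coe_ofNat, two_mul]
    exact add_le_add (le_max_left _ _) (le_max_right _ _)
  exact this.uniformContinuous

namespace UniformSpace.Completion

noncomputable instance instMaxOfLattice : Max (Completion L) := ⟨Completion.map₂ (· ⊔ ·)⟩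

noncomputable instance instMinOfLattice : Min (Completion L) := ⟨Completion.map₂ (· ⊓ ·)⟩

theorem coe_sup (x y : L) : ((x ⊔ y : L) : Completion L) = (x : Completion L) ⊔ y :=
  (Completion.map₂_coe_coe x y _ uniformContinuous₂_sup).symm

theorem coe_inf (x y : L) : ((x ⊓ y : L) : Completion L) = (x : Completion L) ⊓ y :=
  (Completion.map₂_coe_coe x y _ uniformContinuous₂_inf).symm

instance instContinuousSupOfLattice : ContinuousSup (Completion L) :=
  ⟨Completion.continuous_map₂ continuous_fst continuous_snd⟩

instance instContinuousInfOfLattice : ContinuousInf (Completion L) :=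
  ⟨Completion.continuous_map₂ continuous_fst continuous_snd⟩

/-- The lattice operations of a normed lattice, extended to its completion by continuity. -/
noncomputable instance instLatticeOfSolidNorm : Lattice (Completion L) :=
  Lattice.mk'
    (fun a b => by
      induction a, b using Completion.induction_on₂ with
      | hp => exact isClosed_eq (by fun_prop) (by fun_prop)
      | ih a b => rw [← coe_sup, ← coe_sup, sup_comm])
    (fun a b c => by
      induction a, b, c using Completion.induction_on₃ with
      | hp => exact isClosed_eq (by fun_prop) (by fun_prop)
      | ih a b c => simp only [← coe_sup, sup_assoc])
    (fun a b => by
      induction a, b using Completion.induction_on₂ with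
      | hp => exact isClosed_eq (by fun_prop) (by fun_prop)
      | ih a b => rw [← coe_inf, ← coe_inf, inf_comm])
    (fun a b c => by
      induction a, b, c using Completion.induction_on₃ with
      | hp => exact isClosed_eq (by fun_prop) (by fun_prop)
      | ih a b c => simp only [← coe_inf, inf_assoc])
    (fun a b => by
      induction a, b using Completion.induction_on₂ with
      | hp => exact isClosed_eq (by fun_prop) (by fun_prop)
      | ih a b => rw [← coe_inf, ← coe_sup, sup_inf_self])
    (fun a b => by
      induction a, b using Completion.induction_on₂ with
      | hp => exact isClosed_eq (by fun_prop) (by fun_prop)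
      | ih a b => rw [← coe_sup, ← coe_inf, inf_sup_self])

/-- A relation `a ≤ b` need not pass to arbitrary approximants of `a` and `b`. The axiom is
therefore derived from an unconditional identity, which is a closed condition and extends from `L`
by density. -/
instance instIsOrderedAddMonoidOfSolidNorm : IsOrderedAddMonoid (Completion L) := by
  have key : ∀ a b c : Completion L, a ⊔ b + c = (a + c) ⊔ (b + c) := fun a b c => by
    induction a, b, c using Completion.induction_on₃ with
    | hp => exact isClosed_eq (by fun_prop) (by fun_prop)
    | ih a b c => simp only [← coe_sup, ← Completion.coe_add, sup_add]
  refine { add_le_add_left := fun a b h c => ?_ }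
  rw [← sup_eq_right, ← key, sup_eq_right.2 h]

theorem coe_abs (x : L) : ((|x| : L) : Completion L) = |(x : Completion L)| := by
  rw [abs, abs, coe_sup, Completion.coe_neg]

instance instHasSolidNorm : HasSolidNorm (Completion L) := by
  have hcont : Continuous fun x : Completion L => |x| := by
    change Continuous fun x : Completion L => x ⊔ -x
    fun_prop
  have norm_abs : ∀ a : Completion L, ‖|a|‖ = ‖a‖ := fun a => by
    induction a using Completion.induction_on with
    | hp => exact isClosed_eq (by fun_prop) (by fun_prop)
    | ih a => rw [← coe_abs, norm_coe, norm_coe, norm_abs_eq_norm]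
  -- Replacing `|a|` by `|a| ⊓ |b|` removes the hypothesis `|a| ≤ |b|`, so density applies.
  have norm_inf : ∀ a b : Completion L, ‖|a| ⊓ |b|‖ ≤ ‖b‖ := fun a b => by
    induction a, b using Completion.induction_on₂ with
    | hp => exact isClosed_le (by fun_prop) (by fun_prop)
    | ih a b =>
      rw [← coe_abs, ← coe_abs, ← coe_inf, norm_coe, norm_coe]
      refine norm_le_norm_of_abs_le_abs ?_
      rw [abs_of_nonneg (le_inf (abs_nonneg a) (abs_nonneg b))]
      exact inf_le_right
  refine ⟨fun a b h => ?_⟩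
  rw [← norm_abs a, ← inf_eq_left.2 h]
  exact norm_inf a b

instance instIsBanachLattice [NormedSpace ℝ L] [IsOrderedModule ℝ L] :
    IsBanachLattice (Completion L) where
  smul_le_smul_of_nonneg_left c hc a b h := by
    have hsmul : Continuous fun x : Completion L => c • x := continuous_const_smul c
    have key : ∀ a b : Completion L, c • (a ⊔ b) = c • a ⊔ c • b := fun a b => by
      induction a, b using Completion.induction_on₂ with
      | hp =>
        have hr : Continuous fun p : Completion L × Completion L => c • p.1 ⊔ c • p.2 :=
          (hsmul.comp continuous_fst).sup (hsmul.comp continuous_snd)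
        exact isClosed_eq (hsmul.comp (continuous_fst.sup continuous_snd)) hr
      | ih a b =>
        have : IsVectorLattice L := {}
        simp only [← coe_sup, ← Completion.coe_smul, smul_sup_of_nonneg hc]
    rw [← sup_eq_right, ← key, sup_eq_right.2 h]
  smul_le_smul_of_nonneg_right a ha c d h := by
    -- Using `|a|` in place of a positive `a` again makes the condition unconditional.
    have key : ∀ a : Completion L, c • |a| ⊔ d • |a| = d • |a| := fun a => by
      have hcont : Continuous fun x : Completion L => |x| := by
        change Continuous fun x : Completion L => x ⊔ -x
        fun_prop
      have hsmul : ∀ r : ℝ, Continuous fun x : Completion L => r • |x| := fun r =>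
        (continuous_const_smul r).comp hcont
      induction a using Completion.induction_on with
      | hp => exact isClosed_eq ((hsmul c).sup (hsmul d)) (hsmul d)
      | ih a =>
        rw [← coe_abs, ← Completion.coe_smul, ← Completion.coe_smul, ← coe_sup,
          sup_eq_right.2 (smul_le_smul_of_nonneg_right h (abs_nonneg a))]
    have := key a
    rwa [abs_of_nonneg ha, sup_eq_right] at this

end UniformSpace.Completion

end Completion

theorem IsLatticeNorm.exists_completion {L : Type u} [AddCommGroup L] [Module ℝ L] [Lattice L]
    [IsVectorLattice L] {N : L → ℝ} (hN : IsLatticeNorm N) :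
    ∃ (X : Type u) (_ : NormedAddCommGroup X) (_ : NormedSpace ℝ X) (_ : Lattice X)
      (j : L →ₗ[ℝ] X), IsLatticeCompletion N j := by
  let n : AddGroupNorm L :=
    { toFun := N
      map_zero' := by simpa using hN.smul 0 0
      add_le' := hN.add_le
      neg' := fun x => by simpa using hN.smul (-1) x
      eq_zero_of_map_eq_zero' := hN.eq_zero }
  let _ : NormedAddCommGroup L := n.toNormedAddCommGroup
  let _ : NormedSpace ℝ L := ⟨fun c x => (hN.smul c x).le⟩
  have : HasSolidNorm L := ⟨fun x y h => hN.solid x y h⟩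
  exact ⟨UniformSpace.Completion L, inferInstance, inferInstance, inferInstance,
    (UniformSpace.Completion.toComplL : L →L[ℝ] UniformSpace.Completion L),
    inferInstance,
    ⟨UniformSpace.Completion.coe_sup, UniformSpace.Completion.coe_inf⟩,
    UniformSpace.Completion.norm_coe, UniformSpace.Completion.denseRange_coe⟩

/-! ### Automatic continuity and extension from a dense sublattice. -/

section AutomaticContinuity

variable {X Y : Type*} [NormedAddCommGroup X] [NormedSpace ℝ X] [Lattice X]
  [NormedAddCommGroup Y] [NormedSpace ℝ Y] [Lattice Y]

/-- A lattice homomorphism from a Banach lattice to a normed lattice is automatically bounded. -/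
theorem IsLatticeHom.exists_norm_le [IsBanachLattice X] [IsVectorLattice Y] [HasSolidNorm Y]
    {S : X →ₗ[ℝ] Y} (hS : IsLatticeHom S) : ∃ C : ℝ, ∀ x, ‖S x‖ ≤ C * ‖x‖ := by
  by_contra! h
  -- The factor `n * 2 ^ n` lets the rescaled moduli `y n` have norm `2 ^ (-n)`, hence be summable,
  -- while `‖S (y n)‖ > n`.
  choose x hx using fun n : ℕ => h (n * 2 ^ n)
  have hx0 : ∀ n, 0 < ‖x n‖ := fun n => by
    refine norm_pos_iff.2 fun h0 => ?_
    have := hx n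
    rw [h0, map_zero, norm_zero, norm_zero, mul_zero] at this
    exact lt_irrefl _ this
  let y : ℕ → X := fun n => (2 ^ n * ‖x n‖)⁻¹ • |x n|
  have hr : ∀ n, 0 < 2 ^ n * ‖x n‖ := fun n => mul_pos (by positivity) (hx0 n)
  have hy0 : ∀ n, 0 ≤ y n := fun n => smul_nonneg (inv_nonneg.2 (hr n).le) (abs_nonneg _)
  have hynorm : ∀ n, ‖y n‖ = (1 / 2) ^ n := fun n => by
    rw [norm_smul, norm_abs_eq_norm, norm_inv, Real.norm_of_nonneg (hr n).le, mul_inv, mul_assoc,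
      inv_mul_cancel₀ (hx0 n).ne', mul_one, one_div, inv_pow]
  have hsum : Summable y := Summable.of_norm (by
    simp only [hynorm]
    exact summable_geometric_two)
  have hSy : ∀ n : ℕ, (n : ℝ) < ‖S (y n)‖ := fun n => by
    rw [map_smul, hS.map_abs, norm_smul, norm_abs_eq_norm, norm_inv,
      Real.norm_of_nonneg (hr n).le, lt_inv_mul_iff₀ (hr n)]
    calc 2 ^ n * ‖x n‖ * (n : ℝ) = n * 2 ^ n * ‖x n‖ := by ring
      _ < _ := hx n
  obtain ⟨n, hn⟩ := exists_nat_gt ‖S (∑' n, y n)‖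
  -- Each `y n` lies below the sum, so solidity bounds all `‖S (y n)‖` by the norm of the image of
  -- that sum.
  refine lt_irrefl _ ((hn.trans (hSy n)).trans_le (norm_le_norm_of_abs_le_abs ?_))
  rw [← hS.map_abs, ← hS.map_abs, abs_of_nonneg (hy0 n), abs_of_nonneg (tsum_nonneg hy0)]
  exact hS.monotone (hsum.le_tsum n fun m _ => hy0 m)

theorem IsLatticeHom.of_denseRange {L : Type*} [AddCommGroup L] [Module ℝ L] [Lattice L]
    [IsVectorLattice X] [HasSolidNorm X] [IsVectorLattice Y] [HasSolidNorm Y]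
    {j : L →ₗ[ℝ] X} (hj : IsLatticeHom j) (hd : DenseRange j)
    {T : X →L[ℝ] Y} (hT : IsLatticeHom ((T : X →ₗ[ℝ] Y) ∘ₗ j)) :
    IsLatticeHom (T : X →ₗ[ℝ] Y) := by
  refine ⟨fun x y => ?_, fun x y => ?_⟩
  · refine hd.induction_on₂ (p := fun x y => T (x ⊔ y) = T x ⊔ T y)
      (isClosed_eq (by fun_prop) (by fun_prop)) (fun a b => ?_) x y
    rw [← hj.1]
    exact hT.1 a b
  · refine hd.induction_on₂ (p := fun x y => T (x ⊓ y) = T x ⊓ T y)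
      (isClosed_eq (by fun_prop) (by fun_prop)) (fun a b => ?_) x y
    rw [← hj.2]
    exact hT.2 a b

end AutomaticContinuity

/-! ### The free Banach lattice. -/

theorem IsLatticeHom.comp {E F G : Type*} [AddCommGroup E] [Module ℝ E] [Lattice E]
    [AddCommGroup F] [Module ℝ F] [Lattice F] [AddCommGroup G] [Module ℝ G] [Lattice G]
    {S : F →ₗ[ℝ] G} {T : E →ₗ[ℝ] F} (hS : IsLatticeHom S) (hT : IsLatticeHom T) :
    IsLatticeHom (S ∘ₗ T) :=
  ⟨fun x y => by simp [hT.1, hS.1], fun x y => by simp [hT.2, hS.2]⟩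

theorem FVL.isFreeBanachLattice_of_isLatticeCompletion {A : Type u} [Nonempty A] {X : Type v}
    [NormedAddCommGroup X] [NormedSpace ℝ X] [Lattice X] {j : FVL A →ₗ[ℝ] X}
    (hj : IsLatticeCompletion FVL.freeNorm j) :
    IsFreeBanachLattice.{u, v, w} (fun a : A => j (FVL.delta a)) := by
  have hX := hj.isBanachLattice
  have hle : ∀ a, ‖j (FVL.delta a)‖ ≤ 1 := fun a =>
    (hj.norm_eq _).le.trans (FVL.freeNorm_delta_le_one a)
  refine ⟨hX, isBounded_iff_forall_norm_le.2 ⟨1, by rintro _ ⟨a, rfl⟩; exact hle a⟩, ?_⟩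
  intro Y _ _ _ hY κ hκ
  have hbdd : BddAbove (Set.range fun a => ‖κ a‖) := by
    obtain ⟨C, hC⟩ := isBounded_iff_forall_norm_le.1 hκ
    exact ⟨C, by rintro _ ⟨a, rfl⟩; exact hC _ ⟨a, rfl⟩⟩
  have hC0 : 0 ≤ ⨆ a, ‖κ a‖ := Real.iSup_nonneg fun a => norm_nonneg _
  obtain ⟨T, hT, hTκ⟩ := FVL.exists_latticeHom κ
  have hTle : ∀ f, ‖T f‖ ≤ (⨆ a, ‖κ a‖) * ‖j f‖ := fun f => by
    rw [hj.norm_eq]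
    exact FVL.norm_apply_le_mul_freeNorm hT hC0 (fun a => (hTκ a).symm ▸ le_ciSup hbdd a) f
  have hext : ∀ f, T.extendOfNorm j (j f) = T f :=
    LinearMap.extendOfNorm_eq hj.denseRange ⟨_, hTle⟩
  have hcomp : (T.extendOfNorm j : X →ₗ[ℝ] Y) ∘ₗ j = T := LinearMap.ext hext
  refine ⟨T.extendOfNorm j, ⟨hj.isLatticeHom.of_denseRange hj.denseRange (hcomp.symm ▸ hT),
    fun a => (hext _).trans (hTκ a), le_antisymm ?_ ?_⟩, fun S hS hSκ => ?_⟩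
  · exact LinearMap.opNorm_extendOfNorm_le hj.denseRange hC0 hTle
  -- Since `‖ι a‖ ≤ 1`, each `‖κ a‖ = ‖T (ι a)‖` is at most the operator norm.
  · refine ciSup_le fun a => ?_
    rw [← hTκ a, ← hext]
    exact (ContinuousLinearMap.le_opNorm _ _).trans
      (mul_le_of_le_one_right (norm_nonneg _) (hle a))
  -- `S` is merely linear and lattice preserving; automatic continuity makes agreement on the dense
  -- range of `j` sufficient.
  · obtain ⟨C, hC⟩ := hS.exists_norm_le
    have hSj : S ∘ₗ j = T :=
      FVL.latticeHom_ext (hS.comp hj.isLatticeHom) hT fun a => (hSκ a).trans (hTκ a).symm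
    have : ⇑(S.mkContinuous C hC) = T.extendOfNorm j :=
      hj.denseRange.equalizer (ContinuousLinearMap.continuous _) (ContinuousLinearMap.continuous _)
        (funext fun f => (LinearMap.congr_fun hSj f).trans (hext f).symm)
    exact LinearMap.ext fun x => congrFun this x

theorem theorem4 (A : Type u) [Nonempty A] :
    -- `FVL A` is the free vector lattice over `A`
    IsFreeVectorLattice.{u, u, w} (FVL.delta : A → FVL A) ∧
    -- the supremum defining the free norm is finite, and the free norm is a lattice norm
    (∀ f : FVL A, IsLUB (FVL.normValues f) (FVL.freeNorm f)) ∧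
    IsLatticeNorm (FVL.freeNorm : FVL A → ℝ) ∧
    -- the completion exists and is a Banach lattice
    (∃ (X : Type u) (_ : NormedAddCommGroup X) (_ : NormedSpace ℝ X) (_ : Lattice X)
      (j : FVL A →ₗ[ℝ] X), IsLatticeCompletion FVL.freeNorm j) ∧
    -- the completion, with the images of the generators, is the free Banach lattice over `A`
    ∀ (X : Type v) [NormedAddCommGroup X] [NormedSpace ℝ X] [Lattice X]
      (j : FVL A →ₗ[ℝ] X), IsLatticeCompletion FVL.freeNorm j →
        IsFreeBanachLattice.{u, v, w} (fun a : A => j (FVL.delta a)) :=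
  ⟨FVL.isFreeVectorLattice A, FVL.isLUB_freeNorm, FVL.isLatticeNorm_freeNorm,
    FVL.isLatticeNorm_freeNorm.exists_completion,
    fun _ _ _ _ _ hj => FVL.isFreeBanachLattice_of_isLatticeCompletion hj⟩
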